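/- \textbf{Theorem.} Let $\alpha\in[1,3/2)$ and let $\{\phi_\gamma\}_{\gamma\in(0,1)}$ be a family of functions $\phi_\gamma:[0,1]\to\mathbb R$ with $\phi_\gamma(\gamma)=0$ for all $\gamma\in(0,1)$. Suppose that the second divergence speed of every $\phi_\gamma$ is $p^\alpha$, i.e. $\phi_\gamma$ is twice continuously differentiable on $(0,1)$ and there are constants $W_\gamma>0$, $c_\gamma\ge 0$, $c'_\gamma\ge 0$ with $$W_\gamma\,p^{\alpha-2}-c'_\gamma\;\le\;|\phi_\gamma''(p)|\;\le\;W_\gamma\,p^{\alpha-2}+c_\gamma\qquad\text{for all }p\in(0,1),$$ and that these constants are uniform in the sense that $\inf_{\gamma}W_\gamma>0$, $\sup_\gamma c_\gamma<\infty$ and $\sup_\gamma c'_\gamma<\infty$ (for instance, they do not depend on $\gamma$). Put $\phi^\star_\gamma(x)=\phi_\gamma(x)/x$, and for an interval $I$ and $L\in\mathbb N$ let $E_L(f,I)=\inf_{g}\sup_{x\in I}|f(x)-g(x)|$, where $g$ ranges over the real polynomials of degree at most $L$. (i) If $\alpha=1$ and $\phi_\gamma'(\gamma)=0$ for every $\gamma\in(0,1)$,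 then $$\liminf_{L\to\infty,\ \gamma\downarrow 0:\ \gamma\le 1/(2L^2)}E_L\bigl(\phi^\star_\gamma,[\gamma,2L^2\gamma]\bigr)>0.$$ (ii) If $\alpha\in(1,3/2)$ and the (one-sided) derivative $\phi_\gamma'(0)$ exists and equals $0$ for every $\gamma\in(0,1)$, then $$\liminf_{L\to\infty,\ \gamma\downarrow 0:\ \gamma\le 1/(2L^2)}\gamma^{1-\alpha}\,E_L\bigl(\phi^\star_\gamma,[\gamma,2L^2\gamma]\bigr)>0.$$ -/

import Mathlib

open scoped ENNReal Topology

noncomputable section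

/-- The `ℓ`-th divergence speed of `φ : [0,1] → ℝ` is `p ^ α`, with constants `W`, `c`, `c'`:
`φ` is `ℓ` times continuously differentiable on `(0,1)` and
`W p ^ (α - ℓ) - c' ≤ |φ^(ℓ)(p)| ≤ W p ^ (α - ℓ) + c` for all `p ∈ (0,1)`.
Functions on `[0,1]` are represented by total functions on `ℝ`, whose values outside `[0,1]`
play no role. -/
structure HasDivergenceSpeedWith (ℓ : ℕ) (α W c c' : ℝ) (φ : ℝ → ℝ) : Prop where
  contDiffOn : ContDiffOn ℝ ℓ φ (Set.Ioo 0 1)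
  W_pos : 0 < W
  c_nonneg : 0 ≤ c
  c'_nonneg : 0 ≤ c'
  lower : ∀ p ∈ Set.Ioo (0 : ℝ) 1, W * p ^ (-(ℓ : ℝ) + α) - c' ≤ |iteratedDeriv ℓ φ p|
  upper : ∀ p ∈ Set.Ioo (0 : ℝ) 1, |iteratedDeriv ℓ φ p| ≤ W * p ^ (-(ℓ : ℝ) + α) + c

/-- The best polynomial approximation error
`E_L(f, I) = inf_{deg g ≤ L} sup_{x ∈ I} |f x - g x|`, as an extended nonnegative real. -/
def bestApproxError (L : ℕ) (f : ℝ → ℝ) (I : Set ℝ) : ℝ≥0∞ :=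
  ⨅ (g : Polynomial ℝ) (_ : g.natDegree ≤ L), ⨆ x ∈ I, ENNReal.ofReal |f x - g.eval x|

/-- The mode of convergence `L → ∞`, `γ → 0` (`γ > 0`) subject to `γ ≤ 1 / (2 L²)`. -/
def constrainedLimit : Filter (ℕ × ℝ) :=
  (Filter.atTop ×ˢ 𝓝[>] (0 : ℝ)) ⊓
    Filter.principal {q : ℕ × ℝ | q.2 ≤ 1 / (2 * (q.1 : ℝ) ^ 2)}

end

/-! The proof is by duality. For each `L` one constructs a finite signed measure with weights `w j`
at points `u j` of `[1, 1 + L²]` that annihilates polynomials of degree at most `L + 1`, has `∑ |w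
j| u j ^ 2` bounded uniformly in `L`, and gives `1 / (u + s)` a nonnegative value for `s ≥ 0`, at
least `d > 0` for `s ≤ 1`. If `g` of degree at most `L` approximates `φ x / x` within `e`, then `x *
g x` has degree at most `L + 1`, so testing `φ (γ u)` gives at most `e γ B`.

From below, `φ''` is, up to sign and the factor `W`, equal to `p ^ (α - 2)` plus a bounded error. A
model `F` with `F'' = p ^ (α - 2)` is, modulo affine functions, a positive mixture of the kernels `1
/ (u + s)`, so its test value is at least of order `γ ^ α`. The bounded remainder contributes `O(γ ^
2)` after Taylor expansion, which is negligible as `α < 2`. Comparing the two bounds gives `e ≥ κ γ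
^ (α - 1)`.

The measure (`exists_test_functional`) is the alternating sum over Chebyshev extremal nodes, damped
by the cube of a Fejér polynomial: the signs give annihilation and positivity on the kernels, the
damping gives the uniform weighted bound. -/

/-! ### Alternating sums over Chebyshev extremal nodes -/

open Polynomial Finset in
/-- Discrete orthogonality of the alternating signs to low frequencies on the nodes `jπ/N`. -/
theorem sum_neg_one_pow_mul_cos {N : ℕ} {i : ℤ} (hi : |i| < N) :
    ∑ j ∈ range (2 * N), (-1 : ℝ) ^ j * Real.cos (i * (j * Real.pi / N)) = 0 := by
  have hN : (0 : ℝ) < N := by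
    have : (0 : ℤ) < N := lt_of_le_of_lt (abs_nonneg i) hi
    exact_mod_cast this
  obtain ⟨hi1, hi2⟩ := abs_lt.1 hi
  have hi1' : -(N : ℝ) < i := by exact_mod_cast hi1
  have hi2' : (i : ℝ) < N := by exact_mod_cast hi2
  -- The sign `(-1) ^ j` shifts the frequency by `N`, turning the summand into `cos (j β)`;
  -- multiplication by `2 sin (β / 2)`, nonzero because `|i| < N`, makes the sum telescope.
  set β : ℝ := (N + i) * Real.pi / N with hβ
  have hβ0 : 0 < β / 2 := by
    have : 0 < (N : ℝ) + i := by linarith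
    positivity
  have hβ1 : β / 2 < Real.pi := by
    rw [hβ, div_div, div_lt_iff₀ (by positivity)]
    nlinarith [Real.pi_pos]
  have hs : 0 < Real.sin (β / 2) := Real.sin_pos_of_pos_of_lt_pi hβ0 hβ1
  have hterm : ∀ j : ℕ, (-1 : ℝ) ^ j * Real.cos (i * (j * Real.pi / N)) = Real.cos (j * β) := by
    intro j
    have : (j : ℝ) * β = i * (j * Real.pi / N) + j * Real.pi := by
      rw [hβ]; field_simp; ring
    rw [this, Real.cos_add_nat_mul_pi]
  have htel : ∀ n : ℕ, (∑ j ∈ range n, Real.cos (j * β)) * (2 * Real.sin (β / 2)) =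
      Real.sin (n * β - β / 2) + Real.sin (β / 2) := by
    intro n
    induction n with
    | zero => simp [Real.sin_neg]
    | succ n ih =>
      rw [sum_range_succ, add_mul, ih]
      have h1 : ((n + 1 : ℕ) : ℝ) * β - β / 2 = n * β + β / 2 := by push_cast; ring
      rw [h1, Real.sin_add, Real.sin_sub]; ring
  have h0 := htel (2 * N)
  have h1 : ((2 * N : ℕ) : ℝ) * β - β / 2 = -(β / 2) + ((N + i : ℤ) : ℝ) * (2 * Real.pi) := by
    rw [hβ]; push_cast; field_simp; ring
  rw [h1, Real.sin_add_int_mul_two_pi, Real.sin_neg, neg_add_cancel] at h0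
  rw [sum_congr rfl fun j _ => hterm j]
  exact (mul_eq_zero.1 h0).resolve_right (by positivity)

-- Each factor of cosine splits a frequency `i` into `i + 1` and `i - 1`, so `k` factors keep all
-- frequencies below `N`. The extra frequency `i` is there for the induction; only `i = 0` is used
-- later.
open Finset in
theorem sum_neg_one_pow_mul_cos_pow_mul_cos {N : ℕ} (k : ℕ) : ∀ {i : ℤ}, k + |i| < N →
    ∑ j ∈ range (2 * N), (-1 : ℝ) ^ j *
      (Real.cos (j * Real.pi / N) ^ k * Real.cos (i * (j * Real.pi / N))) = 0 := by
  induction k with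
  | zero => intro i hi; simpa using sum_neg_one_pow_mul_cos (by simpa using hi)
  | succ k ih =>
    intro i hi
    have h1 : (k : ℤ) + |i + 1| < N := by
      have := abs_add_le i 1
      push_cast at hi; simp at this; omega
    have h2 : (k : ℤ) + |i - 1| < N := by
      have := abs_sub i 1
      push_cast at hi; simp at this; omega
    have key : ∀ x : ℝ, Real.cos x ^ (k + 1) * Real.cos (i * x) =
        (Real.cos x ^ k * Real.cos ((i + 1 : ℤ) * x) +
          Real.cos x ^ k * Real.cos ((i - 1 : ℤ) * x)) / 2 := by
      intro x
      have e1 : ((i + 1 : ℤ) : ℝ) * x = i * x + x := by push_cast; ring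
      have e2 : ((i - 1 : ℤ) : ℝ) * x = i * x - x := by push_cast; ring
      rw [e1, e2, Real.cos_add, Real.cos_sub]; ring
    have hsum := congrArg₂ (· + ·) (ih h1) (ih h2)
    simp only [← sum_add_distrib, add_zero] at hsum
    rw [← zero_div (2 : ℝ), ← hsum, sum_div]
    refine sum_congr rfl fun j _ => ?_
    rw [key]; ring

open Polynomial Finset in
/-- The alternating sum over the Chebyshev extremal nodes annihilates polynomials of degree less
than `N`. -/
theorem sum_neg_one_pow_mul_eval_cos {N : ℕ} {P : ℝ[X]} (hP : P.natDegree < N) :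
    ∑ j ∈ range (2 * N), (-1 : ℝ) ^ j * P.eval (Real.cos (j * Real.pi / N)) = 0 := by
  simp_rw [eval_eq_sum_range' hP, mul_sum]
  rw [sum_comm]
  refine sum_eq_zero fun k hk => ?_
  have h := sum_neg_one_pow_mul_cos_pow_mul_cos (N := N) k (i := 0)
    (by simpa using mem_range.1 hk)
  simp only [Int.cast_zero, zero_mul, Real.cos_zero, mul_one] at h
  have : ∀ j : ℕ, (-1 : ℝ) ^ j * (P.coeff k * Real.cos (j * Real.pi / N) ^ k) =
      P.coeff k * ((-1 : ℝ) ^ j * Real.cos (j * Real.pi / N) ^ k) := fun j => by ring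
  simp_rw [this, ← mul_sum, h, mul_zero]

open Polynomial Finset in
/-- The alternating sum of `K / (b - x)` over the Chebyshev extremal nodes. -/
theorem sum_neg_one_pow_mul_eval_cos_div {N : ℕ} (hN : N ≠ 0) {K : ℝ[X]} (hK : K.natDegree ≤ N)
    {b : ℝ} (hb : 1 < b) :
    (Chebyshev.T ℝ N).eval b *
      ∑ j ∈ range (2 * N), (-1 : ℝ) ^ j * (K.eval (Real.cos (j * Real.pi / N)) /
        (b - Real.cos (j * Real.pi / N))) =
    K.eval b * ∑ j ∈ range (2 * N), 1 / (b - Real.cos (j * Real.pi / N)) := by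
  set x : ℕ → ℝ := fun j => Real.cos (j * Real.pi / N) with hx
  have hbx : ∀ j, b - x j ≠ 0 := fun j => by
    have := Real.cos_le_one (j * Real.pi / N)
    simp only [hx]; linarith
  have hquot : ∀ P : ℝ[X], P.natDegree ≤ N → ∃ Q : ℝ[X], Q.natDegree < N ∧
      ∀ y, P.eval y = P.eval b + (y - b) * Q.eval y := by
    intro P hP
    refine ⟨P /ₘ (X - C b), ?_, fun y => ?_⟩
    · rw [natDegree_divByMonic _ (monic_X_sub_C b), natDegree_X_sub_C]; omega
    · have := congrArg (eval y) (X_sub_C_mul_divByMonic_eq_sub_modByMonic P b)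
      simp at this
      linarith
  -- `(P - P(b)) / (X - b)` is a polynomial of degree less than `N`, hence annihilated; only the
  -- constant `P(b)` survives. Comparing `P = K` with `P = T_N`, which equals `(-1) ^ j` at the
  -- nodes, removes the signs.
  have hsum : ∀ P : ℝ[X], P.natDegree ≤ N →
      ∑ j ∈ range (2 * N), (-1 : ℝ) ^ j * (P.eval (x j) / (b - x j)) =
        P.eval b * ∑ j ∈ range (2 * N), (-1 : ℝ) ^ j / (b - x j) := by
    intro P hP
    obtain ⟨Q, hQ, hPQ⟩ := hquot P hP
    have h0 := sum_neg_one_pow_mul_eval_cos hQ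
    rw [← sub_eq_zero, mul_sum, ← sum_sub_distrib, ← neg_eq_zero, ← sum_neg_distrib, ← h0]
    refine sum_congr rfl fun j _ => ?_
    rw [hPQ (x j)]
    have := hbx j
    simp only [hx] at this ⊢
    field_simp; ring
  have hT := hsum (Chebyshev.T ℝ N) (by rw [Chebyshev.natDegree_T]; simp)
  have hTx : ∀ j : ℕ, (Chebyshev.T ℝ N).eval (x j) = (-1) ^ j := by
    intro j
    have h1 : (((N : ℕ) : ℤ) : ℝ) * (j * Real.pi / N) = 0 + j * Real.pi := by
      have : (N : ℝ) ≠ 0 := by exact_mod_cast hN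
      push_cast; field_simp; ring
    simp only [hx]
    rw [Chebyshev.T_real_cos, h1, Real.cos_add_nat_mul_pi]
    simp
  rw [hsum K hK, mul_left_comm, ← hT]
  congr 1
  refine sum_congr rfl fun j _ => ?_
  rw [hTx, mul_div_assoc', ← mul_pow]; simp [hx]

/-! ### Fejér polynomials: size at the endpoint, growth beyond it, decay inside -/

open Polynomial in
/-- The Fejér polynomial `(T_m - 1) / (X - 1)`, nonnegative on `[-1, 1]`. -/
noncomputable def fejerPolynomial (m : ℕ) : ℝ[X] := (Chebyshev.T ℝ m - 1) /ₘ (X - C 1)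

open Polynomial in
theorem X_sub_one_mul_fejerPolynomial (m : ℕ) :
    (X - C 1) * fejerPolynomial m = Chebyshev.T ℝ m - 1 :=
  mul_divByMonic_eq_iff_isRoot.2 (by simp [IsRoot])

open Polynomial in
theorem sub_one_mul_eval_fejerPolynomial (m : ℕ) (x : ℝ) :
    (x - 1) * (fejerPolynomial m).eval x = (Chebyshev.T ℝ m).eval x - 1 := by
  simpa using congrArg (eval x) (X_sub_one_mul_fejerPolynomial m)

open Polynomial in
theorem natDegree_fejerPolynomial_le (m : ℕ) : (fejerPolynomial m).natDegree ≤ m - 1 := by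
  rw [fejerPolynomial, natDegree_divByMonic _ (monic_X_sub_C 1), natDegree_X_sub_C]
  have : (Chebyshev.T ℝ m - 1).natDegree ≤ m := by
    refine (natDegree_sub_le _ _).trans ?_
    rw [Chebyshev.natDegree_T]; simp
  omega

-- Differentiating `(X - 1) * fejerPolynomial m = T_m - 1` at `1` leaves `T_m'(1) = m²`.
open Polynomial in
theorem eval_one_fejerPolynomial (m : ℕ) : (fejerPolynomial m).eval 1 = (m : ℝ) ^ 2 := by
  have h := congrArg (fun p => (derivative p).eval 1) (X_sub_one_mul_fejerPolynomial m)
  simp [derivative_mul, Chebyshev.derivative_T_eval_one] at h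
  simpa using h

open Polynomial in
theorem one_sub_mul_abs_eval_fejerPolynomial_le (m : ℕ) {x : ℝ} (hx : |x| ≤ 1) :
    (1 - x) * |(fejerPolynomial m).eval x| ≤ 2 := by
  have h1 := Chebyshev.abs_eval_T_real_le_one m hx
  have h2 := sub_one_mul_eval_fejerPolynomial m x
  have h3 : 0 ≤ 1 - x := by linarith [(abs_le.1 hx).2]
  rw [← abs_of_nonneg h3, ← abs_mul]
  rw [show (1 - x) * (fejerPolynomial m).eval x = 1 - (Chebyshev.T ℝ m).eval x by linarith]
  rw [abs_le] at h1 ⊢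
  constructor <;> linarith

theorem nat_mul_sinh_le_sinh_nat_mul (m : ℕ) {y : ℝ} (hy : 0 ≤ y) :
    m * Real.sinh y ≤ Real.sinh (m * y) := by
  induction m with
  | zero => simp
  | succ m ih =>
    have hs : 0 ≤ Real.sinh y := Real.sinh_nonneg_iff.2 hy
    have hs' : 0 ≤ Real.sinh (m * y) := Real.sinh_nonneg_iff.2 (by positivity)
    push_cast
    rw [add_mul, one_mul, add_mul, one_mul, Real.sinh_add]
    nlinarith [Real.one_le_cosh y, Real.one_le_cosh (m * y)]

theorem cosh_sub_one_eq (z : ℝ) : Real.cosh z - 1 = 2 * Real.sinh (z / 2) ^ 2 := by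
  have h1 := Real.cosh_two_mul (z / 2)
  have h3 := Real.cosh_sq (z / 2)
  rw [mul_div_cancel₀ z two_ne_zero] at h1
  linarith

-- With `b = cosh y`, the value is `(cosh (m y) - 1) / (cosh y - 1) = (sinh (m y / 2) / sinh (y /
-- 2))²`, and `sinh (m z) ≥ m sinh z`.
open Polynomial in
theorem sq_le_eval_fejerPolynomial (m : ℕ) {b : ℝ} (hb : 1 < b) :
    (m : ℝ) ^ 2 ≤ (fejerPolynomial m).eval b := by
  have h2 := sub_one_mul_eval_fejerPolynomial m b
  set y := Real.arcosh b with hy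
  have hc : Real.cosh y = b := Real.cosh_arcosh hb.le
  have hy0 : 0 ≤ y := Real.arcosh_nonneg hb.le
  have hT : (Chebyshev.T ℝ m).eval b = Real.cosh (m * y) := by
    rw [← hc, Chebyshev.T_real_cosh]; simp
  have hs := nat_mul_sinh_le_sinh_nat_mul m (y := y / 2) (by positivity)
  have hs0 : 0 ≤ Real.sinh (y / 2) := Real.sinh_nonneg_iff.2 (by positivity)
  have hsq := pow_le_pow_left₀ (by positivity) hs 2
  rw [hT, cosh_sub_one_eq, mul_div_assoc] at h2
  have hb1 : b - 1 = 2 * Real.sinh (y / 2) ^ 2 := by rw [← cosh_sub_one_eq, hc]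
  refine le_of_mul_le_mul_left ?_ (sub_pos.2 hb)
  rw [h2, hb1]
  nlinarith

-- Writing `b = cosh y`, one has `T_n(b) = cosh (n y)`, while `1 + y² / 2 ≤ cosh y` forces `y ≤ a`.
open Polynomial in
theorem eval_T_le_cosh {n : ℕ} {b a : ℝ} (hb : 1 ≤ b) (ha : 0 ≤ a) (hba : b ≤ 1 + a ^ 2 / 2) :
    (Chebyshev.T ℝ n).eval b ≤ Real.cosh (n * a) := by
  have hc : Real.cosh (Real.arcosh b) = b := Real.cosh_arcosh hb
  have hy0 : 0 ≤ Real.arcosh b := Real.arcosh_nonneg hb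
  have hT : (Chebyshev.T ℝ n).eval b = Real.cosh (n * Real.arcosh b) := by
    conv_lhs => rw [← hc]
    rw [Chebyshev.T_real_cosh]; simp
  have hle : Real.arcosh b ≤ a := by
    have hsq : 1 + Real.arcosh b ^ 2 / 2 ≤ b := by
      have h1 := cosh_sub_one_eq (Real.arcosh b)
      have h2 : Real.arcosh b / 2 ≤ Real.sinh (Real.arcosh b / 2) :=
        Real.self_le_sinh_iff.2 (by positivity)
      have h3 := pow_le_pow_left₀ (by positivity) h2 2
      rw [hc] at h1
      linarith
    nlinarith
  rw [hT, Real.cosh_le_cosh, abs_of_nonneg (by positivity), abs_of_nonneg (by positivity)]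
  gcongr

open Polynomial in
/-- The cube of the Fejér polynomial, normalized to be `1` at `1`. -/
noncomputable def cubedFejerPolynomial (L : ℕ) : ℝ[X] :=
  (C (((L : ℝ) ^ 2)⁻¹) * fejerPolynomial L) ^ 3

open Polynomial in
theorem natDegree_cubedFejerPolynomial_le (L : ℕ) :
    (cubedFejerPolynomial L).natDegree ≤ 3 * (L - 1) :=
  natDegree_pow_le.trans <| Nat.mul_le_mul_left _ <|
    (natDegree_C_mul_le _ _).trans (natDegree_fejerPolynomial_le L)

open Polynomial in
theorem eval_one_cubedFejerPolynomial {L : ℕ} (hL : L ≠ 0) :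
    (cubedFejerPolynomial L).eval 1 = 1 := by
  have : (L : ℝ) ≠ 0 := by exact_mod_cast hL
  simp [cubedFejerPolynomial, eval_one_fejerPolynomial, this]

open Polynomial in
theorem one_le_eval_cubedFejerPolynomial {L : ℕ} (hL : L ≠ 0) {b : ℝ} (hb : 1 < b) :
    1 ≤ (cubedFejerPolynomial L).eval b := by
  have hL' : (0 : ℝ) < L := by exact_mod_cast Nat.pos_of_ne_zero hL
  simp only [cubedFejerPolynomial, eval_pow, eval_mul, eval_C]
  refine one_le_pow₀ ?_
  rw [inv_mul_eq_div, one_le_div (by positivity)]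
  exact sq_le_eval_fejerPolynomial L hb

open Polynomial in
/-- Decay of the test weights away from the left endpoint. -/
theorem abs_eval_cubedFejerPolynomial_mul_sq_le {L : ℕ} (hL : L ≠ 0) {k : ℕ} (hk : k ≠ 0)
    (hkL : k ≤ 4 * L) :
    |(cubedFejerPolynomial L).eval (Real.cos (k * Real.pi / (4 * L : ℕ)))| *
      (1 + (L : ℝ) ^ 2 * (1 - Real.cos (k * Real.pi / (4 * L : ℕ))) / 2) ^ 2 ≤
      16384 * (1 / (k : ℝ) ^ 2) := by
  have hL' : (0 : ℝ) < L := by exact_mod_cast Nat.pos_of_ne_zero hL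
  have hk' : (1 : ℝ) ≤ k := by exact_mod_cast Nat.pos_of_ne_zero hk
  have hkL' : (k : ℝ) ≤ 4 * L := by exact_mod_cast hkL
  set t : ℝ := k * Real.pi / (4 * L : ℕ) with ht
  have ht' : t = k * Real.pi / (4 * L) := by rw [ht]; push_cast; ring
  have ht0 : 0 ≤ t := by positivity
  have htπ : t ≤ Real.pi := by
    rw [ht', div_le_iff₀ (by positivity)]
    nlinarith [Real.pi_pos]
  have hx : |Real.cos t| ≤ 1 := Real.abs_cos_le_one t
  have hlow : (k : ℝ) ^ 2 / (8 * L ^ 2) ≤ 1 - Real.cos t := by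
    have h := Real.cos_le_one_sub_mul_cos_sq (x := t) (by rwa [abs_of_nonneg ht0])
    have : 2 / Real.pi ^ 2 * t ^ 2 = (k : ℝ) ^ 2 / (8 * L ^ 2) := by
      rw [ht']; have := Real.pi_pos.ne'; field_simp; ring
    linarith
  have hup : (L : ℝ) ^ 2 * (1 - Real.cos t) / 2 ≤ k ^ 2 := by
    have h := Real.one_sub_sq_div_two_le_cos (x := t)
    have h1 : (L : ℝ) ^ 2 * (1 - Real.cos t) / 2 ≤ L ^ 2 * (t ^ 2 / 2) / 2 := by
      gcongr; linarith
    have h2 : (L : ℝ) ^ 2 * (t ^ 2 / 2) / 2 = k ^ 2 * (Real.pi ^ 2 / 64) := by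
      rw [ht']; field_simp; ring
    have h3 : Real.pi ^ 2 / 64 ≤ 1 := by nlinarith [Real.pi_le_four, Real.pi_pos]
    rw [h2] at h1
    nlinarith [sq_nonneg (k : ℝ)]
  have hu0 : 0 ≤ (L : ℝ) ^ 2 * (1 - Real.cos t) / 2 := by
    have : 0 ≤ 1 - Real.cos t := le_trans (by positivity) hlow
    positivity
  -- The normalized Fejér polynomial is `O(k⁻²)` and the weight squared is `O(k⁴)`. The cube is the
  -- least power for which this gives a summable product, here `16³ * 4 / k²`.
  have hF : ((L : ℝ) ^ 2)⁻¹ * |(fejerPolynomial L).eval (Real.cos t)| ≤ 16 / k ^ 2 := by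
    have h := one_sub_mul_abs_eval_fejerPolynomial_le L hx
    have h' := (mul_le_mul_of_nonneg_right hlow (abs_nonneg _)).trans h
    rw [inv_mul_eq_div, div_le_div_iff₀ (by positivity) (by positivity)]
    rw [div_mul_eq_mul_div, div_le_iff₀ (by positivity)] at h'
    linarith
  have hK : |(cubedFejerPolynomial L).eval (Real.cos t)| ≤ (16 / k ^ 2) ^ 3 := by
    simp only [cubedFejerPolynomial, eval_pow, eval_mul, eval_C, abs_pow, abs_mul]
    rw [abs_of_nonneg (a := ((L : ℝ) ^ 2)⁻¹) (by positivity)]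
    gcongr
  calc _ ≤ (16 / (k : ℝ) ^ 2) ^ 3 * (2 * k ^ 2) ^ 2 := by
        gcongr
        nlinarith
    _ = _ := by field_simp; ring

-- The nodes `j` and `8L - j` coincide, so the pointwise decay applies on both halves; the node `j =
-- 0` contributes exactly `1`.
open Polynomial Finset in
theorem sum_abs_eval_cubedFejerPolynomial_mul_sq_le {L : ℕ} (hL : L ≠ 0) :
    ∑ j ∈ range (2 * (4 * L)), |(cubedFejerPolynomial L).eval
      (Real.cos (j * Real.pi / (4 * L : ℕ)))| *
      (1 + (L : ℝ) ^ 2 * (1 - Real.cos (j * Real.pi / (4 * L : ℕ))) / 2) ^ 2 ≤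
      1 + 32768 * ∑' n : ℕ, 1 / (n : ℝ) ^ 2 := by
  have hL' : (0 : ℝ) < L := by exact_mod_cast Nat.pos_of_ne_zero hL
  have hsum : Summable fun n : ℕ => 1 / (n : ℝ) ^ 2 := by simp
  set S := ∑' n : ℕ, 1 / (n : ℝ) ^ 2 with hS
  set M := 2 * (4 * L) with hM
  have hterm : ∀ j ∈ range M, |(cubedFejerPolynomial L).eval
      (Real.cos (j * Real.pi / (4 * L : ℕ)))| *
      (1 + (L : ℝ) ^ 2 * (1 - Real.cos (j * Real.pi / (4 * L : ℕ))) / 2) ^ 2 ≤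
      (if j = 0 then 1 else 0) +
        (16384 * (1 / (j : ℝ) ^ 2) + 16384 * (1 / ((M - j : ℕ) : ℝ) ^ 2)) := by
    intro j hj
    have hjM := mem_range.1 hj
    by_cases hj0 : j = 0
    · subst hj0
      simp [eval_one_cubedFejerPolynomial hL]
    rw [if_neg hj0, zero_add]
    by_cases hjL : j ≤ 4 * L
    · exact (abs_eval_cubedFejerPolynomial_mul_sq_le hL hj0 hjL).trans
        (le_add_of_nonneg_right (by positivity))
    · have h := abs_eval_cubedFejerPolynomial_mul_sq_le hL (k := M - j) (by omega) (by omega)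
      have hcos : Real.cos (((M - j : ℕ) : ℝ) * Real.pi / (4 * L : ℕ)) =
          Real.cos (j * Real.pi / (4 * L : ℕ)) := by
        rw [← Real.cos_two_pi_sub, Nat.cast_sub hjM.le, hM]
        congr 1; push_cast; field_simp; ring
      rw [hcos] at h
      exact h.trans (le_add_of_nonneg_left (by positivity))
  have h1 : ∑ j ∈ range M, 1 / (j : ℝ) ^ 2 ≤ S := hsum.sum_le_tsum _ fun _ _ => by positivity
  have h2 : ∑ j ∈ range M, 1 / ((M - j : ℕ) : ℝ) ^ 2 ≤ S := by
    calc ∑ j ∈ range M, 1 / ((M - j : ℕ) : ℝ) ^ 2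
        = ∑ j ∈ range M, 1 / ((M - 1 - j + 1 : ℕ) : ℝ) ^ 2 := by
          refine sum_congr rfl fun j hj => ?_
          have := mem_range.1 hj
          rw [show M - j = M - 1 - j + 1 by omega]
      _ = ∑ j ∈ range M, 1 / ((j + 1 : ℕ) : ℝ) ^ 2 :=
          sum_range_reflect (fun j => 1 / ((j + 1 : ℕ) : ℝ) ^ 2) M
      _ ≤ ∑ j ∈ range (M + 1), 1 / (j : ℝ) ^ 2 := by
          rw [sum_range_succ' _ M]; simp
      _ ≤ S := hsum.sum_le_tsum _ fun _ _ => by positivity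
  refine (sum_le_sum hterm).trans ?_
  rw [sum_add_distrib, sum_add_distrib, ← mul_sum, ← mul_sum]
  have h3 : ∑ j ∈ range M, (if j = 0 then (1 : ℝ) else 0) ≤ 1 := by
    rw [sum_ite_eq']; split_ifs <;> norm_num
  linarith

/-! ### The test functional -/

open Polynomial Finset in
/-- A functional on `[1, 1 + L²]` that annihilates polynomials of degree at most `L + 1`, is
bounded (with quadratic weight) uniformly in `L`, is nonnegative on all `1 / (u + s)` with
`0 ≤ s`, and is bounded below uniformly in `L` when `s ≤ 1`. -/
theorem exists_test_functional : ∃ B d : ℝ, 0 < B ∧ 0 < d ∧ ∀ L : ℕ, L ≠ 0 →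
    ∃ (n : ℕ) (w u : ℕ → ℝ),
      (∀ j, 1 ≤ u j ∧ u j ≤ 1 + (L : ℝ) ^ 2) ∧
      (∀ P : ℝ[X], P.natDegree ≤ L + 1 → ∑ j ∈ range n, w j * P.eval (u j) = 0) ∧
      ∑ j ∈ range n, |w j| * u j ^ 2 ≤ B ∧
      (∀ s : ℝ, 0 ≤ s → 0 ≤ ∑ j ∈ range n, w j / (u j + s)) ∧
      (∀ s : ℝ, 0 ≤ s → s ≤ 1 → d ≤ ∑ j ∈ range n, w j / (u j + s)) := by
  refine ⟨1 + 32768 * ∑' n : ℕ, 1 / (n : ℝ) ^ 2, 1 / (2 * Real.cosh 12), ?_, ?_, ?_⟩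
  · have : 0 ≤ ∑' n : ℕ, 1 / (n : ℝ) ^ 2 := tsum_nonneg fun _ => by positivity
    positivity
  · have := Real.cosh_pos 12
    positivity
  intro L hL
  have hL' : (0 : ℝ) < L := by exact_mod_cast Nat.pos_of_ne_zero hL
  set x : ℕ → ℝ := fun j => Real.cos (j * Real.pi / (4 * L : ℕ)) with hx
  set u : ℕ → ℝ := fun j => 1 + (L : ℝ) ^ 2 * (1 - x j) / 2 with hu
  set w : ℕ → ℝ := fun j => (-1) ^ j * (cubedFejerPolynomial L).eval (x j) with hw
  have hx1 : ∀ j, x j ≤ 1 := fun j => Real.cos_le_one _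
  have hx2 : ∀ j, -1 ≤ x j := fun j => Real.neg_one_le_cos _
  have hKdeg := natDegree_cubedFejerPolynomial_le L
  have key : ∀ s : ℝ, 0 ≤ s → 1 / (1 + s) ≤
      (Chebyshev.T ℝ (4 * L : ℕ)).eval (1 + 2 * (1 + s) / L ^ 2) *
        ∑ j ∈ range (2 * (4 * L)), w j / (u j + s) := by
    intro s hs
    -- This `b` is the pole `u = -s` in the Chebyshev variable: `u j + s = (L² / 2) * (b - x j)`.
    set b : ℝ := 1 + 2 * (1 + s) / L ^ 2 with hb
    have hb1 : 1 < b := by rw [hb]; have : 0 < 2 * (1 + s) / (L : ℝ) ^ 2 := by positivity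
                           linarith
    have hid := sum_neg_one_pow_mul_eval_cos_div (N := 4 * L) (by omega)
      (K := cubedFejerPolynomial L) (by omega) hb1
    have hsum : ∑ j ∈ range (2 * (4 * L)), w j / (u j + s) = 2 / (L : ℝ) ^ 2 *
        ∑ j ∈ range (2 * (4 * L)), (-1 : ℝ) ^ j * ((cubedFejerPolynomial L).eval (x j) /
        (b - x j)) := by
      rw [mul_sum]
      refine sum_congr rfl fun j _ => ?_
      have h1 : u j + s = (L : ℝ) ^ 2 / 2 * (b - x j) := by
        simp only [hu, hb]; field_simp; ring
      have h2 : b - x j ≠ 0 := by have := hx1 j; linarith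
      rw [h1]; simp only [hw]; field_simp
    -- All terms are positive, so the one at the endpoint node `x 0 = 1` suffices.
    have hS : 1 / (b - 1) ≤ ∑ j ∈ range (2 * (4 * L)), 1 / (b - x j) := by
      have h0 : 1 / (b - 1) = 1 / (b - x 0) := by simp [hx]
      rw [h0]
      refine single_le_sum (f := fun j => 1 / (b - x j)) (fun j _ => ?_)
        (mem_range.2 (by omega))
      have := hx1 j
      exact one_div_nonneg.2 (by linarith)
    have hK := one_le_eval_cubedFejerPolynomial hL hb1
    have hpos : 0 < b - 1 := by linarith
    rw [hsum, mul_left_comm, hid]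
    calc 1 / (1 + s) = 2 / (L : ℝ) ^ 2 * (1 * (1 / (b - 1))) := by
          rw [hb]; field_simp; ring
      _ ≤ _ := by gcongr
  have hT : ∀ s : ℝ, 0 ≤ s → 1 ≤ (Chebyshev.T ℝ (4 * L : ℕ)).eval (1 + 2 * (1 + s) / (L : ℝ) ^ 2) :=
    fun s hs => Chebyshev.one_le_eval_T_real _ (le_add_of_nonneg_right (by positivity))
  have hnonneg : ∀ s : ℝ, 0 ≤ s → 0 ≤ ∑ j ∈ range (2 * (4 * L)), w j / (u j + s) := by
    intro s hs
    have h1 : 0 ≤ 1 / (1 + s) := by positivity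
    exact nonneg_of_mul_nonneg_right (h1.trans (key s hs)) (by linarith [hT s hs])
  refine ⟨2 * (4 * L), w, u, fun j => ?_, fun P hP => ?_, ?_, hnonneg, fun s hs hs1 => ?_⟩
  · have h1 := hx1 j
    have h2 := hx2 j
    simp only [hu]
    constructor
    · have : 0 ≤ (L : ℝ) ^ 2 * (1 - x j) / 2 := by
        have : 0 ≤ 1 - x j := by linarith
        positivity
      linarith
    · nlinarith [sq_nonneg (L : ℝ)]
  -- The degree is at most `3 (L - 1) + (L + 1) = 4L - 2 < 4L`.
  · have h := sum_neg_one_pow_mul_eval_cos (N := 4 * L) (P := cubedFejerPolynomial L *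
      P.comp (C (1 + (L : ℝ) ^ 2 / 2) + C (-((L : ℝ) ^ 2 / 2)) * X)) (by
        refine lt_of_le_of_lt natDegree_mul_le ?_
        have h1 : (P.comp (C (1 + (L : ℝ) ^ 2 / 2) + C (-((L : ℝ) ^ 2 / 2)) * X)).natDegree ≤
            (L + 1) * 1 := by
          refine natDegree_comp_le.trans (Nat.mul_le_mul hP ?_)
          compute_degree
        omega)
    rw [← h]
    refine sum_congr rfl fun j _ => ?_
    simp only [eval_mul, eval_comp, eval_add, eval_C, eval_X, hw, hu, hx]
    rw [mul_assoc]
    congr 3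
    ring
  · have h := sum_abs_eval_cubedFejerPolynomial_mul_sq_le hL
    refine le_trans (le_of_eq (sum_congr rfl fun j _ => ?_)) h
    simp [hw, hu, hx, abs_mul]
  -- For `s ≤ 1`, `b ≤ 1 + 4 / L² ≤ 1 + (3 / L)² / 2`, and `4L * (3 / L) = 12`.
  · have hTle : (Chebyshev.T ℝ (4 * L : ℕ)).eval (1 + 2 * (1 + s) / (L : ℝ) ^ 2) ≤
        Real.cosh 12 := by
      have h := eval_T_le_cosh (n := 4 * L) (b := 1 + 2 * (1 + s) / (L : ℝ) ^ 2) (a := 3 / L)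
        (le_add_of_nonneg_right (by positivity)) (by positivity) (by
          rw [div_pow, div_div, add_le_add_iff_left, div_le_div_iff₀ (by positivity)
            (by positivity)]
          nlinarith [sq_nonneg (L : ℝ)])
      refine h.trans_eq ?_
      congr 1; push_cast; field_simp; norm_num
    have h1 : 1 / 2 ≤ 1 / (1 + s) := one_div_le_one_div_of_le (by linarith) (by linarith)
    have h2 := mul_le_mul_of_nonneg_right hTle (hnonneg s hs)
    have h3 := key s hs
    have := Real.cosh_pos 12
    rw [div_le_iff₀ (by positivity)]
    linarith

/-! ### Lower bounds on the model functions -/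

open Finset in
/-- A functional annihilating affine functions and with `∑ w / (u + s) ≥ 0` is positive on
`u log u`. -/
theorem half_le_sum_mul_mul_log {n : ℕ} {w u : ℕ → ℝ} {d : ℝ} (hu : ∀ j, 1 ≤ u j)
    (h0 : ∑ j ∈ range n, w j = 0) (h1 : ∑ j ∈ range n, w j * u j = 0)
    (hD : ∀ s : ℝ, 0 ≤ s → 0 ≤ ∑ j ∈ range n, w j / (u j + s))
    (hD1 : ∀ s : ℝ, 0 ≤ s → s ≤ 1 → d ≤ ∑ j ∈ range n, w j / (u j + s)) :
    d / 2 ≤ ∑ j ∈ range n, w j * (u j * Real.log (u j)) := by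
  -- Since `u / (u + s) = 1 - s / (u + s)`, `H'(s) = -s ∑ w / (u + s)`; and `H` vanishes at infinity
  -- because `∑ w u = 0`. So the target `H 0` is `∫ s ∑ w / (u + s) ds`, handled through
  -- monotonicity instead of integration.
  set H : ℝ → ℝ := fun s => ∑ j ∈ range n, w j * (u j * Real.log (u j + s)) with hH
  have hpos : ∀ j, ∀ s : ℝ, 0 ≤ s → 0 < u j + s := fun j s hs => by linarith [hu j]
  have hderiv : ∀ s : ℝ, 0 ≤ s →
      HasDerivAt H (-(s * ∑ j ∈ range n, w j / (u j + s))) s := by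
    intro s hs
    have hd : HasDerivAt H (∑ j ∈ range n, w j * (u j * (1 / (u j + s)))) s := by
      refine HasDerivAt.fun_sum fun j _ => ?_
      exact ((((hasDerivAt_id s).const_add (u j)).log (hpos j s hs).ne').const_mul _).const_mul _
    convert hd using 1
    rw [mul_sum, ← sub_eq_zero, ← sum_neg_distrib, ← sum_sub_distrib, ← neg_eq_zero,
      ← sum_neg_distrib, ← h0]
    refine sum_congr rfl fun j _ => ?_
    have := (hpos j s hs).ne'
    field_simp; ring
  have hcont : ∀ s : ℝ, 0 ≤ s → ContinuousAt H s := fun s hs => (hderiv s hs).continuousAt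
  have hanti : AntitoneOn H (Set.Ici 0) := by
    refine antitoneOn_of_deriv_nonpos (convex_Ici 0)
      (fun s hs => (hcont s hs).continuousWithinAt) (fun s hs => ?_) (fun s hs => ?_)
    · rw [interior_Ici] at hs
      exact (hderiv s (le_of_lt hs)).differentiableAt.differentiableWithinAt
    · rw [interior_Ici] at hs
      rw [(hderiv s (le_of_lt hs)).deriv]
      have := mul_nonneg (le_of_lt hs) (hD s (le_of_lt hs))
      linarith
  have hderiv2 : ∀ s : ℝ, 0 ≤ s → HasDerivAt (fun s => H s + d * s ^ 2 / 2)
      (-(s * ∑ j ∈ range n, w j / (u j + s)) + d * s) s := by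
    intro s hs
    refine ((hderiv s hs).add
      ((((hasDerivAt_id s).pow 2).const_mul d).div_const 2)).congr_deriv ?_
    simp only [id]; push_cast; ring
  have hanti2 : AntitoneOn (fun s => H s + d * s ^ 2 / 2) (Set.Icc 0 1) := by
    refine antitoneOn_of_deriv_nonpos (convex_Icc 0 1)
      (fun s hs => (hderiv2 s hs.1).continuousAt.continuousWithinAt) (fun s hs => ?_)
      (fun s hs => ?_)
    · rw [interior_Icc] at hs
      exact (hderiv2 s hs.1.le).differentiableAt.differentiableWithinAt
    · rw [interior_Icc] at hs
      rw [(hderiv2 s hs.1.le).deriv]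
      have := mul_le_mul_of_nonneg_left (hD1 s hs.1.le hs.2.le) hs.1.le
      linarith
  have hlim : Filter.Tendsto H Filter.atTop (𝓝 0) := by
    have hlim' : Filter.Tendsto (fun s : ℝ => ∑ j ∈ range n,
        w j * (u j * Real.log (1 + u j / s))) Filter.atTop (𝓝 0) := by
      rw [show (0 : ℝ) = ∑ j ∈ range n, w j * (u j * Real.log (1 + 0)) by simp]
      refine tendsto_finsetSum _ fun j _ => ?_
      refine Filter.Tendsto.const_mul _ (Filter.Tendsto.const_mul _ ?_)
      refine Filter.Tendsto.log ?_ (by norm_num)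
      exact (tendsto_const_nhds).add (tendsto_const_nhds.div_atTop Filter.tendsto_id)
    refine hlim'.congr' ?_
    filter_upwards [Filter.eventually_gt_atTop 0] with s hs
    have : ∀ j, w j * (u j * Real.log (1 + u j / s)) =
        w j * (u j * Real.log (u j + s)) - w j * u j * Real.log s := by
      intro j
      rw [show 1 + u j / s = (u j + s) / s by field_simp; ring,
        Real.log_div (hpos j s hs.le).ne' hs.ne']
      ring
    simp_rw [this, sum_sub_distrib, ← sum_mul, h1]
    simp [hH]
  have hH1 : 0 ≤ H 1 := by
    refine le_of_tendsto hlim ?_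
    filter_upwards [Filter.eventually_ge_atTop 1] with s hs
    exact hanti (Set.mem_Ici.2 zero_le_one) (Set.mem_Ici.2 (by linarith)) hs
  have h01 := hanti2 (Set.left_mem_Icc.2 zero_le_one) (Set.right_mem_Icc.2 zero_le_one)
    zero_le_one
  have hH0 : H 0 = ∑ j ∈ range n, w j * (u j * Real.log (u j)) := by simp [hH]
  simp only at h01
  linarith

open Finset MeasureTheory in
/-- A functional annihilating affine functions and with `∑ w / (u + s) ≥ 0` is positive on
`u ^ (1 + p)`. -/
theorem div_le_sum_mul_mul_rpow {n : ℕ} {w u : ℕ → ℝ} {d p : ℝ} (hp : p ∈ Set.Ioo (0 : ℝ) 1)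
    (hu : ∀ j, 1 ≤ u j)
    (h0 : ∑ j ∈ range n, w j = 0) (h1 : ∑ j ∈ range n, w j * u j = 0)
    (hD : ∀ s : ℝ, 0 ≤ s → 0 ≤ ∑ j ∈ range n, w j / (u j + s))
    (hD1 : ∀ s : ℝ, 0 ≤ s → s ≤ 1 → d ≤ ∑ j ∈ range n, w j / (u j + s)) :
    d / (p + 2) ≤ (∑ j ∈ range n, w j * (u j * u j ^ p)) *
      ∫ t in Set.Ioi 0, Real.rpowIntegrand₀₁ p t 1 := by
  set G : ℝ → ℝ := fun t => ∑ j ∈ range n, w j * u j * Real.rpowIntegrand₀₁ p t (u j) with hG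
  have hint : ∀ j, IntegrableOn (fun t => w j * u j * Real.rpowIntegrand₀₁ p t (u j))
      (Set.Ioi 0) := fun j =>
    (Real.integrableOn_rpowIntegrand₀₁_Ioi hp (by linarith [hu j])).const_mul _
  have hGint : IntegrableOn G (Set.Ioi 0) := integrable_finsetSum _ fun j _ => hint j
  have hGI : (∑ j ∈ range n, w j * (u j * u j ^ p)) *
      ∫ t in Set.Ioi 0, Real.rpowIntegrand₀₁ p t 1 = ∫ t in Set.Ioi 0, G t := by
    rw [hG, integral_finsetSum _ fun j _ => hint j, sum_mul]
    refine sum_congr rfl fun j _ => ?_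
    rw [integral_const_mul,
      Real.integral_rpowIntegrand₀₁_eq_rpow_mul_const hp (x := u j) (by linarith [hu j])]
    ring
  -- Modulo affine functions of `u`, `u * t ^ p * (1 / t - 1 / (t + u))` equals `t ^ (p + 1) / (u +
  -- t)`.
  have hGt : ∀ t : ℝ, 0 < t → G t = t ^ (p + 1) * ∑ j ∈ range n, w j / (u j + t) := by
    intro t ht
    rw [Real.rpow_add_one ht.ne', mul_assoc, mul_sum, mul_sum, ← sub_eq_zero, hG,
      ← sum_sub_distrib]
    have : ∀ j ∈ range n, w j * u j * Real.rpowIntegrand₀₁ p t (u j) -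
        t ^ p * (t * (w j / (u j + t))) = t ^ p / t * (w j * u j) - t ^ p * w j := by
      intro j _
      have h2 : u j + t ≠ 0 := by linarith [hu j]
      have h3 : t + u j ≠ 0 := by linarith [hu j]
      rw [Real.rpowIntegrand₀₁, add_comm t (u j)]
      field_simp; ring
    rw [sum_congr rfl this, sum_sub_distrib, ← mul_sum, ← mul_sum, h0, h1]
    simp
  rw [hGI]
  have hval : ∫ t in Set.Ioc (0 : ℝ) 1, d * t ^ (p + 1) = d / (p + 2) := by
    rw [integral_const_mul, ← intervalIntegral.integral_of_le zero_le_one,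
      integral_rpow (Or.inl (by linarith [hp.1]))]
    rw [Real.zero_rpow (by linarith [hp.1]), Real.one_rpow]
    ring_nf
  have hsub : Set.Ioc (0 : ℝ) 1 ⊆ Set.Ioi 0 := fun t ht => ht.1
  calc d / (p + 2) = ∫ t in Set.Ioc (0 : ℝ) 1, d * t ^ (p + 1) := hval.symm
    _ ≤ ∫ t in Set.Ioc (0 : ℝ) 1, G t := by
        refine setIntegral_mono_on ?_ (hGint.mono_set hsub) measurableSet_Ioc fun t ht => ?_
        · refine Integrable.const_mul ?_ _
          have := intervalIntegral.intervalIntegrable_rpow' (a := 0) (b := 1) (r := p + 1)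
            (by linarith [hp.1])
          rwa [intervalIntegrable_iff_integrableOn_Ioc_of_le zero_le_one] at this
        · rw [hGt t ht.1, mul_comm]
          exact mul_le_mul_of_nonneg_left (hD1 t ht.1.le ht.2) (Real.rpow_nonneg ht.1.le _)
    _ ≤ ∫ t in Set.Ioi 0, G t := by
        refine setIntegral_mono_set hGint ?_ hsub.eventuallyLE
        refine ae_restrict_of_forall_mem measurableSet_Ioi fun t ht => ?_
        rw [hGt t ht]
        exact mul_nonneg (Real.rpow_nonneg (le_of_lt ht) _) (hD t (le_of_lt ht))

open Finset in
/-- A function `F` with `F'' = p ^ (α - 2)` on which functionals as in `exists_test_functional`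
are bounded below, with the expected behaviour under scaling. -/
theorem exists_model {α : ℝ} (hα : α ∈ Set.Ico (1 : ℝ) (3 / 2)) :
    ∃ (F F' : ℝ → ℝ) (κ : ℝ), 0 < κ ∧ (∀ p, 0 < p → HasDerivAt F (F' p) p) ∧
      (∀ p, 0 < p → HasDerivAt F' (p ^ (α - 2)) p) ∧
      ∀ (n : ℕ) (w u : ℕ → ℝ) (d γ : ℝ), (∀ j, 1 ≤ u j) → ∑ j ∈ range n, w j = 0 →
        ∑ j ∈ range n, w j * u j = 0 →
        (∀ s : ℝ, 0 ≤ s → 0 ≤ ∑ j ∈ range n, w j / (u j + s)) →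
        (∀ s : ℝ, 0 ≤ s → s ≤ 1 → d ≤ ∑ j ∈ range n, w j / (u j + s)) → 0 < γ →
        κ * d * γ ^ α ≤ ∑ j ∈ range n, w j * F (γ * u j) := by
  obtain ⟨hα1, hα2⟩ := hα
  rcases hα1.eq_or_lt with rfl | hα1
  · refine ⟨fun p => p * Real.log p, fun p => Real.log p + 1, 1 / 2, by norm_num,
      fun p hp => Real.hasDerivAt_mul_log hp.ne', fun p hp => ?_, ?_⟩
    · refine ((Real.hasDerivAt_log hp.ne').add_const 1).congr_deriv ?_
      rw [show (1 : ℝ) - 2 = -1 by norm_num, Real.rpow_neg_one]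
    · intro n w u d γ hu h0 h1 hD hD1 hγ
      have h := half_le_sum_mul_mul_log hu h0 h1 hD hD1
      have heq : ∑ j ∈ range n, w j * (γ * u j * Real.log (γ * u j)) =
          γ * ∑ j ∈ range n, w j * (u j * Real.log (u j)) := by
        have : ∀ j ∈ range n, w j * (γ * u j * Real.log (γ * u j)) =
            γ * (w j * (u j * Real.log (u j))) + γ * Real.log γ * (w j * u j) := by
          intro j _
          rw [Real.log_mul hγ.ne' (by linarith [hu j])]; ring
        rw [sum_congr rfl this, sum_add_distrib, ← mul_sum, ← mul_sum, h1, mul_zero, add_zero]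
      simp only [Real.rpow_one]
      rw [heq]
      nlinarith
  · have hpα : α - 1 ∈ Set.Ioo (0 : ℝ) 1 := ⟨by linarith, by linarith⟩
    set c := ∫ t in Set.Ioi 0, Real.rpowIntegrand₀₁ (α - 1) t 1 with hc
    have hc0 : 0 < c := Real.integral_rpowIntegrand₀₁_one_pos hpα
    have hα0 : 0 < α := by linarith
    have hα10 : 0 < α - 1 := by linarith
    refine ⟨fun p => p ^ α / (α * (α - 1)), fun p => p ^ (α - 1) / (α - 1),
      1 / ((α + 1) * c * (α * (α - 1))), by positivity, fun p hp => ?_, fun p hp => ?_, ?_⟩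
    · refine ((Real.hasDerivAt_rpow_const (p := α) (Or.inl hp.ne')).div_const
        (α * (α - 1))).congr_deriv ?_
      field_simp
    · refine ((Real.hasDerivAt_rpow_const (p := α - 1) (Or.inl hp.ne')).div_const
        (α - 1)).congr_deriv ?_
      rw [show α - 1 - 1 = α - 2 by ring]
      field_simp
    · intro n w u d γ hu h0 h1 hD hD1 hγ
      have h := div_le_sum_mul_mul_rpow hpα hu h0 h1 hD hD1
      have heq : ∑ j ∈ range n, w j * ((γ * u j) ^ α / (α * (α - 1))) =
          γ ^ α / (α * (α - 1)) * ∑ j ∈ range n, w j * (u j * u j ^ (α - 1)) := by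
        rw [mul_sum]
        refine sum_congr rfl fun j _ => ?_
        have hj : 0 < u j := by linarith [hu j]
        rw [Real.mul_rpow hγ.le hj.le, Real.rpow_sub_one hj.ne']
        field_simp
      rw [heq]
      have hγα : 0 < γ ^ α := Real.rpow_pos_of_pos hγ α
      rw [← hc, ← div_le_iff₀ hc0] at h
      calc _ = γ ^ α / (α * (α - 1)) * (d / (α - 1 + 2) / c) := by
            rw [show α - 1 + 2 = α + 1 by ring]; field_simp
        _ ≤ _ := by gcongr

/-! ### Reduction of `φ` to the model -/

/-- A continuous function whose modulus is uniformly close to `p ^ (α - 2)` is, up to a global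
sign, itself uniformly close to `p ^ (α - 2)`. -/
theorem exists_sign_bound {α : ℝ} (hα : α < 2) {K : ℝ} (hK : 0 ≤ K) :
    ∃ M : ℝ, 0 ≤ M ∧ ∀ v : ℝ → ℝ, ContinuousOn v (Set.Ioo 0 1) →
      (∀ p ∈ Set.Ioo (0 : ℝ) 1, p ^ (α - 2) - K ≤ |v p|) →
      (∀ p ∈ Set.Ioo (0 : ℝ) 1, |v p| ≤ p ^ (α - 2) + K) →
      ∃ σ : ℝ, |σ| = 1 ∧ ∀ p ∈ Set.Ioo (0 : ℝ) 1, |σ * v p - p ^ (α - 2)| ≤ M := by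
  -- Chosen so that `p₀ ^ (α - 2) = K + 2`: below `p₀` one has `|v| ≥ 2`, so `v` keeps one sign;
  -- above it both `|v|` and `p ^ (α - 2)` are bounded.
  set p₀ : ℝ := (K + 2) ^ (-(1 / (2 - α))) with hp₀
  have h2α : 0 < 2 - α := by linarith
  have hp₀0 : 0 < p₀ := Real.rpow_pos_of_pos (by linarith) _
  have hp₀1 : p₀ < 1 := Real.rpow_lt_one_of_one_lt_of_neg (by linarith) (by
    have : 0 < 1 / (2 - α) := by positivity
    linarith)
  have hp₀α : p₀ ^ (α - 2) = K + 2 := by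
    rw [hp₀, ← Real.rpow_mul (by linarith),
      show -(1 / (2 - α)) * (α - 2) = 1 by field_simp; ring, Real.rpow_one]
  have hsmall : ∀ p, 0 < p → p ≤ p₀ → K + 2 ≤ p ^ (α - 2) := fun p hp hpp => by
    rw [← hp₀α]; exact Real.rpow_le_rpow_of_nonpos hp hpp (by linarith)
  have hlarge : ∀ p, p₀ ≤ p → p ^ (α - 2) ≤ K + 2 := fun p hpp => by
    rw [← hp₀α]; exact Real.rpow_le_rpow_of_nonpos hp₀0 hpp (by linarith)
  refine ⟨3 * K + 4, by linarith, fun v hv hlow hup => ?_⟩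
  have hsub : Set.Ioc 0 p₀ ⊆ Set.Ioo (0 : ℝ) 1 := fun p hp => ⟨hp.1, hp.2.trans_lt hp₀1⟩
  have hne : ∀ p ∈ Set.Ioc 0 p₀, v p ≠ 0 := by
    intro p hp h0
    have h1 := hlow p (hsub hp)
    have h2 := hsmall p hp.1 hp.2
    rw [h0, abs_zero] at h1
    linarith
  obtain ⟨σ, hσ, hσv⟩ : ∃ σ : ℝ, |σ| = 1 ∧ ∀ p ∈ Set.Ioc 0 p₀, σ * v p = |v p| := by
    by_cases hpos : ∀ p ∈ Set.Ioc 0 p₀, 0 ≤ v p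
    · exact ⟨1, by simp, fun p hp => by rw [one_mul, abs_of_nonneg (hpos p hp)]⟩
    · push Not at hpos
      obtain ⟨a, ha, hva⟩ := hpos
      refine ⟨-1, by simp, fun p hp => ?_⟩
      rw [neg_one_mul, eq_comm, abs_of_nonpos]
      by_contra! hvp
      obtain ⟨q, hq, hq0⟩ := isPreconnected_Ioc.intermediate_value ha hp (hv.mono hsub)
        (Set.mem_Icc.2 ⟨hva.le, hvp.le⟩)
      exact hne q hq hq0
  refine ⟨σ, hσ, fun p hp => ?_⟩
  have h1 := hlow p hp
  have h2 := hup p hp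
  rcases le_total p p₀ with hpp | hpp
  · rw [hσv p ⟨hp.1, hpp⟩, abs_le]
    constructor <;> linarith
  · have h3 := hlarge p hpp
    have h4 : 0 ≤ p ^ (α - 2) := Real.rpow_nonneg hp.1.le _
    calc |σ * v p - p ^ (α - 2)| ≤ |σ * v p| + |p ^ (α - 2)| := abs_sub _ _
      _ = |v p| + p ^ (α - 2) := by rw [abs_mul, hσ, one_mul, abs_of_nonneg h4]
      _ ≤ 3 * K + 4 := by linarith

/-- First-order Taylor estimate with a bounded second derivative. -/
theorem abs_sub_sub_mul_le {R R' R'' : ℝ → ℝ} {M γ p : ℝ}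
    (hR : ∀ q ∈ Set.Ioo (0 : ℝ) 1, HasDerivAt R (R' q) q)
    (hR' : ∀ q ∈ Set.Ioo (0 : ℝ) 1, HasDerivAt R' (R'' q) q)
    (hM : ∀ q ∈ Set.Ioo (0 : ℝ) 1, |R'' q| ≤ M) (hγ : 0 < γ) (hγp : γ ≤ p) (hp : p < 1) :
    |R p - R γ - R' γ * (p - γ)| ≤ M * (p - γ) ^ 2 := by
  have hsub : Set.Icc γ p ⊆ Set.Ioo (0 : ℝ) 1 := fun q hq =>
    ⟨hγ.trans_le hq.1, hq.2.trans_lt hp⟩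
  have hγm : γ ∈ Set.Icc γ p := Set.left_mem_Icc.2 hγp
  have hpm : p ∈ Set.Icc γ p := Set.right_mem_Icc.2 hγp
  have hM0 : 0 ≤ M := (abs_nonneg _).trans (hM γ (hsub hγm))
  have h1 : ∀ q ∈ Set.Icc γ p, |R' q - R' γ| ≤ M * (p - γ) := by
    intro q hq
    have h := (convex_Icc γ p).norm_image_sub_le_of_norm_hasDerivWithin_le
      (fun x hx => (hR' x (hsub hx)).hasDerivWithinAt) (fun x hx => hM x (hsub hx)) hγm hq
    rw [Real.norm_eq_abs, Real.norm_eq_abs, abs_of_nonneg (sub_nonneg.2 hq.1)] at h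
    exact h.trans (by gcongr; exact hq.2)
  have h2 := (convex_Icc γ p).norm_image_sub_le_of_norm_hasDerivWithin_le
    (f := fun q => R q - R' γ * q) (f' := fun q => R' q - R' γ) (C := M * (p - γ))
    (fun x hx => by
      refine HasDerivAt.hasDerivWithinAt ?_
      exact ((hR x (hsub hx)).sub ((hasDerivAt_id x).const_mul (R' γ))).congr_deriv
        (by rw [mul_one]))
    h1 hγm hpm
  rw [Real.norm_eq_abs, Real.norm_eq_abs, abs_of_nonneg (sub_nonneg.2 hγp)] at h2
  calc _ = |R p - R' γ * p - (R γ - R' γ * γ)| := by congr 1; ring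
    _ ≤ _ := h2
    _ = _ := by ring

theorem HasDivergenceSpeedWith.hasDerivAt {α W c c' : ℝ} {φ : ℝ → ℝ}
    (h : HasDivergenceSpeedWith 2 α W c c' φ) :
    (∀ q ∈ Set.Ioo (0 : ℝ) 1, HasDerivAt φ (deriv φ q) q) ∧
    (∀ q ∈ Set.Ioo (0 : ℝ) 1, HasDerivAt (deriv φ) (iteratedDeriv 2 φ q) q) ∧
    ContinuousOn (iteratedDeriv 2 φ) (Set.Ioo 0 1) := by
  have h1 : ContDiffOn ℝ (1 + 1) φ (Set.Ioo 0 1) := h.contDiffOn.of_le (by norm_num)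
  have h2 := (contDiffOn_succ_iff_deriv_of_isOpen isOpen_Ioo).1 h1
  have h3 : ContDiffOn ℝ 1 (deriv φ) (Set.Ioo 0 1) := h2.2.2
  have heq : iteratedDeriv 2 φ = deriv (deriv φ) := by
    rw [iteratedDeriv_succ, iteratedDeriv_one]
  refine ⟨fun q hq => ((h2.1 q hq).differentiableAt (isOpen_Ioo.mem_nhds hq)).hasDerivAt,
    fun q hq => ?_, ?_⟩
  · rw [heq]
    exact (((h3.differentiableOn one_ne_zero) q hq).differentiableAt
      (isOpen_Ioo.mem_nhds hq)).hasDerivAt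
  · rw [heq]
    exact h3.continuousOn_deriv_of_isOpen isOpen_Ioo le_rfl

/-! ### Lower bound on the approximation error -/

open Polynomial Finset in
/-- The quantitative lower bound for any polynomial approximating `φ x / x`. -/
theorem exists_approx_error_bound {α : ℝ} (hα : α ∈ Set.Ico (1 : ℝ) (3 / 2)) {w₀ C : ℝ}
    (hw₀ : 0 < w₀) (hC : 0 ≤ C) :
    ∃ κ γ₀ : ℝ, 0 < κ ∧ 0 < γ₀ ∧ ∀ (φ : ℝ → ℝ) (W c c' γ : ℝ) (L : ℕ),
      HasDivergenceSpeedWith 2 α W c c' φ → w₀ ≤ W → c ≤ C → c' ≤ C → 0 < γ → γ < γ₀ → 2 ≤ L →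
      γ ≤ 1 / (2 * (L : ℝ) ^ 2) → ∀ (g : ℝ[X]) (e : ℝ), g.natDegree ≤ L → 0 ≤ e →
      (∀ x ∈ Set.Icc γ (2 * (L : ℝ) ^ 2 * γ), |φ x / x - g.eval x| ≤ e) →
      κ * γ ^ (α - 1) ≤ e := by
  obtain ⟨B, d, hB, hd, hfun⟩ := exists_test_functional
  obtain ⟨F, F', κ, hκ, hF, hF', hmodel⟩ := exists_model hα
  obtain ⟨M, hM, hsign⟩ := exists_sign_bound (α := α) (by linarith [hα.2])
    (K := C / w₀) (by positivity)
  have h2α : 0 < 2 - α := by linarith [hα.2]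
  obtain ⟨γ₀, hγ₀, hγ₀M⟩ : ∃ γ₀ : ℝ, 0 < γ₀ ∧ ∀ γ, 0 < γ → γ < γ₀ →
      M * γ ^ 2 * B ≤ κ * d * γ ^ α / 2 := by
    have hlim : Filter.Tendsto (fun γ : ℝ => M * B * γ ^ (2 - α)) (𝓝 0) (𝓝 0) := by
      have h := (Real.continuousAt_rpow_const 0 (2 - α) (Or.inr h2α.le)).tendsto.const_mul (M * B)
      simpa [Real.zero_rpow h2α.ne'] using h
    have hev := hlim.eventually (gt_mem_nhds (show (0 : ℝ) < κ * d / 2 by positivity))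
    obtain ⟨ε, hε, hball⟩ := Metric.eventually_nhds_iff.1 hev
    refine ⟨ε, hε, fun γ hγ hγε => ?_⟩
    have h := hball (y := γ) (by rwa [Real.dist_eq, sub_zero, abs_of_pos hγ])
    have hsplit : γ ^ 2 = γ ^ (2 - α) * γ ^ α := by
      rw [← Real.rpow_add hγ, show 2 - α + α = ((2 : ℕ) : ℝ) by norm_num, Real.rpow_natCast]
    have hγα : 0 < γ ^ α := Real.rpow_pos_of_pos hγ α
    calc M * γ ^ 2 * B = M * B * γ ^ (2 - α) * γ ^ α := by rw [hsplit]; ring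
      _ ≤ κ * d / 2 * γ ^ α := by gcongr
      _ = _ := by ring
  refine ⟨w₀ * (κ * d) / (2 * B), γ₀, by positivity, hγ₀, ?_⟩
  intro φ W c c' γ L hφ hW hc hc' hγ hγγ₀ hL hγL g e hg he happ
  have hL2 : (2 : ℝ) ≤ L := by exact_mod_cast hL
  have hWpos := hφ.W_pos
  obtain ⟨hd1, hd2, hcont⟩ := hφ.hasDerivAt
  obtain ⟨n, w, u, hu, hkill, hwB, hD, hD1⟩ := hfun L (by omega)
  have hu1 : ∀ j, 1 ≤ u j := fun j => (hu j).1
  have h0 : ∑ j ∈ range n, w j = 0 := by simpa using hkill 1 (by simp)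
  have h1 : ∑ j ∈ range n, w j * u j = 0 := by
    simpa using hkill X (by rw [natDegree_X]; omega)
  have hγu : ∀ j, γ ≤ γ * u j ∧ γ * u j < 1 ∧ γ * u j ≤ 2 * (L : ℝ) ^ 2 * γ := by
    intro j
    have h3 : u j < 2 * (L : ℝ) ^ 2 := by nlinarith [(hu j).2]
    refine ⟨by nlinarith [hu1 j], ?_, by nlinarith⟩
    rw [le_div_iff₀ (by positivity)] at hγL
    nlinarith
  have hexp : -((2 : ℕ) : ℝ) + α = α - 2 := by push_cast; ring
  obtain ⟨σ, hσ, hσv⟩ := hsign (fun p => iteratedDeriv 2 φ p / W) (hcont.div_const W)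
    (fun p hp => by
      have h := hφ.lower p hp
      rw [hexp] at h
      rw [abs_div, abs_of_pos hWpos, le_div_iff₀ hWpos, sub_mul]
      have : C ≤ C / w₀ * W := by rw [div_mul_eq_mul_div, le_div_iff₀ hw₀]; gcongr
      linarith)
    (fun p hp => by
      have h := hφ.upper p hp
      rw [hexp] at h
      rw [abs_div, abs_of_pos hWpos, div_le_iff₀ hWpos, add_mul]
      have : C ≤ C / w₀ * W := by rw [div_mul_eq_mul_div, le_div_iff₀ hw₀]; gcongr
      linarith)
  -- The singular parts of the second derivatives cancel, so `|R''| ≤ M`. The functional kills the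
  -- affine Taylor part at `γ`; the quadratic weight controls the rest.
  set R : ℝ → ℝ := fun p => σ / W * φ p - F p with hR
  set R' : ℝ → ℝ := fun p => σ / W * deriv φ p - F' p with hR'
  have htaylor : ∀ j, |R (γ * u j) - R γ - R' γ * (γ * u j - γ)| ≤ M * γ ^ 2 * u j ^ 2 := by
    intro j
    refine (abs_sub_sub_mul_le (R := R) (R' := R')
      (R'' := fun p => σ / W * iteratedDeriv 2 φ p - p ^ (α - 2))
      (fun q hq => ((hd1 q hq).const_mul _).sub (hF q hq.1))
      (fun q hq => ((hd2 q hq).const_mul _).sub (hF' q hq.1))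
      (M := M) (fun q hq => ?_) hγ (hγu j).1 (hγu j).2.1).trans ?_
    · refine le_of_eq_of_le ?_ (hσv q hq)
      congr 1; ring
    · rw [mul_assoc M, ← mul_pow]
      have := (hγu j).1
      gcongr
      linarith
  have hRsum : |∑ j ∈ range n, w j * R (γ * u j)| ≤ M * γ ^ 2 * B := by
    have heq : ∑ j ∈ range n, w j * R (γ * u j) =
        ∑ j ∈ range n, w j * (R (γ * u j) - R γ - R' γ * (γ * u j - γ)) := by
      have : ∀ j ∈ range n, w j * (R (γ * u j) - R γ - R' γ * (γ * u j - γ)) =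
          w j * R (γ * u j) - (R γ - R' γ * γ) * w j - R' γ * γ * (w j * u j) :=
        fun j _ => by ring
      rw [sum_congr rfl this, sum_sub_distrib, sum_sub_distrib, ← mul_sum, ← mul_sum, h0, h1]
      simp
    rw [heq]
    calc _ ≤ ∑ j ∈ range n, |w j| * (M * γ ^ 2 * u j ^ 2) := by
          refine (abs_sum_le_sum_abs _ _).trans (sum_le_sum fun j _ => ?_)
          rw [abs_mul]
          exact mul_le_mul_of_nonneg_left (htaylor j) (abs_nonneg _)
      _ = M * γ ^ 2 * ∑ j ∈ range n, |w j| * u j ^ 2 := by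
          rw [mul_sum]; exact sum_congr rfl fun j _ => by ring
      _ ≤ M * γ ^ 2 * B := by gcongr
  have hφsum : |∑ j ∈ range n, w j * φ (γ * u j)| ≤ e * γ * B := by
    have hpoly := hkill (Polynomial.C γ * X * g.comp (Polynomial.C γ * X)) (by
      refine natDegree_mul_le.trans ?_
      have h3 : (Polynomial.C γ * X : ℝ[X]).natDegree ≤ 1 := by compute_degree
      have h4 : (g.comp (Polynomial.C γ * X)).natDegree ≤ L * 1 :=
        natDegree_comp_le.trans (Nat.mul_le_mul hg h3)
      omega)
    simp only [eval_mul, eval_comp, eval_C, eval_X] at hpoly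
    rw [← sub_zero (∑ j ∈ range n, w j * φ (γ * u j)), ← hpoly, ← sum_sub_distrib]
    calc _ ≤ ∑ j ∈ range n, |w j| * (e * γ * u j ^ 2) := by
          refine (abs_sum_le_sum_abs _ _).trans (sum_le_sum fun j _ => ?_)
          have hpos : 0 < γ * u j := hγ.trans_le (hγu j).1
          have h3 : w j * φ (γ * u j) - w j * (γ * u j * g.eval (γ * u j)) =
              w j * (γ * u j * (φ (γ * u j) / (γ * u j) - g.eval (γ * u j))) := by
            rw [mul_sub (γ * u j), mul_div_cancel₀ _ hpos.ne', mul_sub]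
          rw [h3, abs_mul, abs_mul, abs_of_pos hpos]
          have h4 := happ (γ * u j) ⟨(hγu j).1, (hγu j).2.2⟩
          have h5 : u j ≤ u j ^ 2 := by nlinarith [hu1 j]
          refine mul_le_mul_of_nonneg_left ?_ (abs_nonneg _)
          calc γ * u j * |φ (γ * u j) / (γ * u j) - g.eval (γ * u j)| ≤ γ * u j * e := by gcongr
            _ = e * γ * u j := by ring
            _ ≤ e * γ * u j ^ 2 := by gcongr
      _ = e * γ * ∑ j ∈ range n, |w j| * u j ^ 2 := by
          rw [mul_sum]; exact sum_congr rfl fun j _ => by ring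
      _ ≤ e * γ * B := by gcongr
  have hmain := hmodel n w u d γ hu1 h0 h1 hD hD1 hγ
  have hsplit : ∑ j ∈ range n, w j * R (γ * u j) =
      σ / W * ∑ j ∈ range n, w j * φ (γ * u j) - ∑ j ∈ range n, w j * F (γ * u j) := by
    rw [mul_sum, ← sum_sub_distrib]
    exact sum_congr rfl fun j _ => by simp only [hR]; ring
  have hσφ : σ / W * ∑ j ∈ range n, w j * φ (γ * u j) ≤ e * γ * B / W := by
    refine (le_abs_self _).trans ?_
    rw [abs_mul, abs_div, hσ, abs_of_pos hWpos, one_div_mul_eq_div]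
    gcongr
  have hhalf := hγ₀M γ hγ hγγ₀
  have hfin : κ * d * γ ^ α / 2 ≤ e * γ * B / W := by
    have := (abs_le.1 hRsum).1
    linarith
  have hγα : 0 < γ ^ α := Real.rpow_pos_of_pos hγ α
  have hfin' : κ * d * γ ^ α / 2 * w₀ ≤ e * γ * B := by
    rw [le_div_iff₀ hWpos] at hfin
    exact (mul_le_mul_of_nonneg_left hW (by positivity)).trans hfin
  rw [Real.rpow_sub_one hγ.ne', div_mul_div_comm, div_le_iff₀ (by positivity)]
  linarith

open Polynomial in
/-- The lower bound for the best approximation error, eventually along `constrainedLimit`. -/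
theorem eventually_le_bestApproxError {α : ℝ} (hα : α ∈ Set.Ico (1 : ℝ) (3 / 2))
    {φ : ℝ → ℝ → ℝ} {W c c' : ℝ → ℝ}
    (hφ : ∀ γ ∈ Set.Ioo (0 : ℝ) 1, HasDivergenceSpeedWith 2 α (W γ) (c γ) (c' γ) (φ γ))
    (hW : ∃ w : ℝ, 0 < w ∧ ∀ γ ∈ Set.Ioo (0 : ℝ) 1, w ≤ W γ)
    (hc : ∃ C : ℝ, ∀ γ ∈ Set.Ioo (0 : ℝ) 1, c γ ≤ C ∧ c' γ ≤ C) :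
    ∃ κ : ℝ, 0 < κ ∧ ∀ᶠ q : ℕ × ℝ in constrainedLimit, 0 < q.2 ∧
      ENNReal.ofReal (κ * q.2 ^ (α - 1)) ≤ bestApproxError q.1 (fun x => φ q.2 x / x)
        (Set.Icc q.2 (2 * (q.1 : ℝ) ^ 2 * q.2)) := by
  obtain ⟨w₀, hw₀, hW⟩ := hW
  obtain ⟨C, hC⟩ := hc
  have hC0 : 0 ≤ C := by
    have hm : (1 / 2 : ℝ) ∈ Set.Ioo (0 : ℝ) 1 := by norm_num
    exact (hφ _ hm).c_nonneg.trans (hC _ hm).1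
  obtain ⟨κ, γ₀, hκ, hγ₀, hbound⟩ := exists_approx_error_bound hα hw₀ hC0
  refine ⟨κ, hκ, ?_⟩
  have hev : ∀ᶠ q : ℕ × ℝ in Filter.atTop ×ˢ 𝓝[>] (0 : ℝ),
      2 ≤ q.1 ∧ q.2 ∈ Set.Ioo 0 (min γ₀ 1) :=
    (Filter.eventually_ge_atTop 2).prod_mk (Ioo_mem_nhdsGT (lt_min hγ₀ one_pos))
  rw [constrainedLimit, Filter.eventually_inf_principal]
  filter_upwards [hev] with ⟨L, γ⟩ ⟨hL, hγ, hγmin⟩ hγL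
  have hγm : γ ∈ Set.Ioo (0 : ℝ) 1 := ⟨hγ, hγmin.trans_le (min_le_right _ _)⟩
  refine ⟨hγ, le_iInf₂ fun g hg => ?_⟩
  -- An infinite supremum is trivially large enough; a finite one serves as the real error `e`.
  by_cases htop : (⨆ x ∈ Set.Icc γ (2 * (L : ℝ) ^ 2 * γ),
      ENNReal.ofReal |φ γ x / x - g.eval x|) = ⊤
  · exact htop ▸ le_top
  refine ENNReal.ofReal_le_of_le_toReal ?_
  refine hbound (φ γ) (W γ) (c γ) (c' γ) γ L (hφ γ hγm) (hW γ hγm) (hC γ hγm).1 (hC γ hγm).2 hγ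
    (hγmin.trans_le (min_le_left _ _)) hL hγL g _ hg ENNReal.toReal_nonneg fun x hx => ?_
  rw [← ENNReal.ofReal_le_iff_le_toReal htop]
  exact le_iSup₂ (f := fun x (_ : x ∈ Set.Icc γ (2 * (L : ℝ) ^ 2 * γ)) =>
    ENNReal.ofReal |φ γ x / x - g.eval x|) x hx

theorem mainTheorem12 (α : ℝ) (hα : α ∈ Set.Ico (1 : ℝ) (3 / 2))
    (φ : ℝ → ℝ → ℝ) (W c c' : ℝ → ℝ)
    (hφ : ∀ γ ∈ Set.Ioo (0 : ℝ) 1, HasDivergenceSpeedWith 2 α (W γ) (c γ) (c' γ) (φ γ))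
    (hW : ∃ w : ℝ, 0 < w ∧ ∀ γ ∈ Set.Ioo (0 : ℝ) 1, w ≤ W γ)
    (hc : ∃ C : ℝ, ∀ γ ∈ Set.Ioo (0 : ℝ) 1, c γ ≤ C ∧ c' γ ≤ C)
    (hzero : ∀ γ ∈ Set.Ioo (0 : ℝ) 1, φ γ γ = 0) :
    (α = 1 → (∀ γ ∈ Set.Ioo (0 : ℝ) 1, deriv (φ γ) γ = 0) →
      0 < Filter.liminf
        (fun q : ℕ × ℝ => bestApproxError q.1 (fun x => φ q.2 x / x)
          (Set.Icc q.2 (2 * (q.1 : ℝ) ^ 2 * q.2)))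
        constrainedLimit) ∧
    (α ∈ Set.Ioo (1 : ℝ) (3 / 2) →
      (∀ γ ∈ Set.Ioo (0 : ℝ) 1, HasDerivWithinAt (φ γ) 0 (Set.Icc 0 1) 0) →
      0 < Filter.liminf
        (fun q : ℕ × ℝ => ENNReal.ofReal (q.2 ^ (1 - α)) *
          bestApproxError q.1 (fun x => φ q.2 x / x)
            (Set.Icc q.2 (2 * (q.1 : ℝ) ^ 2 * q.2)))
        constrainedLimit) := by
  obtain ⟨κ, hκ, hev⟩ := eventually_le_bestApproxError hα hφ hW hc
  have hκ' : 0 < ENNReal.ofReal κ := ENNReal.ofReal_pos.2 hκ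
  refine ⟨fun hα1 _ => hκ'.trans_le (Filter.le_liminf_of_le (h := ?_)),
    fun _ _ => hκ'.trans_le (Filter.le_liminf_of_le (h := ?_))⟩
  · filter_upwards [hev] with q hq
    simpa [hα1] using hq.2
  · filter_upwards [hev] with q hq
    refine le_trans (le_of_eq ?_) (mul_le_mul_right hq.2 _)
    rw [← ENNReal.ofReal_mul (Real.rpow_nonneg hq.1.le _), mul_left_comm,
      ← Real.rpow_add hq.1, show 1 - α + (α - 1) = 0 by ring, Real.rpow_zero, mul_one]
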